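/- **Setting.** Fix a many-sorted signature of term symbols and theory symbols over a sorted set of variables. Every theory sort $\iota$ (among them $\mathsf{bool}$) has a carrier $\mathcal I(\iota)$ and a norm $|\cdot|_\iota:\mathcal I(\iota)\to\mathbb N$; the theory symbols comprise exactly one constant (a *value*) for each carrier element, and every theory symbol has a fixed interpretation. A *constraint* is a theory term of sort $\mathsf{bool}$. A (left-linear) *LCTRS* $\mathcal R$ is a set of sorted rules $\rho:\ell\to r\,[\varphi]$, where $\ell$ and $r$ are terms of the same sort, $\ell$ is linear and rooted by a term symbol, and $\varphi$ is a constraint. A substitution $\sigma$ *respects* $\varphi$ if it maps the variables of $\varphi$ to values and $\varphi\sigma$ is valid. A rule step $C[\ell\sigma]\to_\rho C[r\sigma]$ requires that $\sigma$ respects $\varphi$ and that $\sigma$ maps the variables of $r$ that do not occur in $\ell$ to values. $\mathcal R_{\mathsf{calc}}$ is the set of rules $f(c_1,\dots,c_n)\to c$ with $f$ a non-value theory symbol, $c_i$ values and $c$ the value of $f(c_1,\dots,c_n)$; its steps are denoted $\to_{\mathsf{calc}}$ and are always part of $\to_{\mathcal R}$. A step of a system is innermost ($\overset{\mathsf i}{\to}$)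 if all proper subterms of $\ell\sigma$ are normal forms of that system. Write $A/B$ for $B^*\cdot A\cdot B^*$, and $\mathrm{dh}(t,\to)\in\mathbb N\cup\{\omega\}$ for the supremum of the lengths of $\to$-sequences from $t$. An *initial state* of $\mathcal R$ is a pair $(t,\varphi)$ with $t=\mathsf{init}(x_1,\dots,x_n)$, where the $x_i$ are variables, $\mathsf{init}$ is a term symbol that occurs in no right-hand side of $\mathcal R$, and $\varphi$ is a constraint. For a vector $\vec m$ of natural numbers indexed by the variables of $t$, let $\Sigma(\vec m)$ be the set of substitutions $\sigma$ that respect $\varphi$ and map each variable $x$ of $t$ to a value of norm at most $m_x$. The innermost runtime complexity counts rule steps but not calculation steps: $$\mathrm{rc}_{\mathcal R}^{(t,\varphi)}(\vec m)=\sup\{\mathrm{dh}(t\sigma,\ \textstyle\bigcup_{\rho\in\mathcal R}\overset{\mathsf i}{\to}_\rho\,/\to_{\mathsf{calc}})\mid\sigma\in\Sigma(\vec m)\}.$$ For each term symbol $f$ let $f^\sharp$ be a fresh symbol, write $f(\vec s)^\sharp=f^\sharp(\vec s)$, and let $\langle\cdot,\dots,\cdot\rangle$ be fresh tuple symbols.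 The dependency tuple of $\rho:\ell\to r\,[\varphi]$ is $\ell^\sharp\to\langle(r|_{p_1})^\sharp,\dots,(r|_{p_k})^\sharp\rangle\,[\varphi]$, where $p_1,\dots,p_k$ are, in a fixed order, all positions of $r$ that carry a defined symbol (a root symbol of a left-hand side of $\mathcal R$). $\mathsf{DT}(\mathcal R)$ is the set of dependency tuples of all rules of $\mathcal R$. *Bound expressions* are built from sizes $|x|$ of variables, integers and $\omega$ by $p+q$, $pq$, $\max(p,q)$, $k^p$, $p/k$ and $\log_k(p)$ with $k\in\mathbb N$. They are evaluated in the extended reals at $\vec m$ (where $|x|$ is replaced by $m_x$; inequalities are required for all natural values of sizes of other variables). Put $\mathcal D=\mathsf{DT}(\mathcal R)$ and $\mathcal S=\mathcal D\cup\mathcal R\cup\mathcal R_{\mathsf{calc}}$. The judgement $\vdash((t^\sharp,\varphi),\mathcal D,\mathcal R\cup\mathcal R_{\mathsf{calc}}):(T,S)$, where $T$ assigns a bound expression to each $\rho\in\mathcal D$ and $S$ assigns one to each pair $(\rho,y)$ of $\rho\in\mathcal D$ and a variable $y$ of its left-hand side, is *valid* if for all $\vec m$, with innermost steps taken with respect to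 $\mathcal S$: 1. for every $\rho\in\mathcal D$, $\ T(\rho)(\vec m)\ge\sup\{\mathrm{dh}(t^\sharp\sigma,\overset{\mathsf i}{\to}_\rho/\overset{\mathsf i}{\to}_{\mathcal S})\mid\sigma\in\Sigma(\vec m)\}$; 2. for every such $(\rho,y)$, $S(\rho,y)(\vec m)$ is at least the supremum of the norms $|y\tau|$ over all sequences $t^\sharp\sigma\overset{\mathsf i}{\to}{}^*_{\mathcal S}\ s\overset{\mathsf i}{\to}_\rho u$ with $\sigma\in\Sigma(\vec m)$ whose last step uses a substitution $\tau$ with $y\tau$ a value. **Theorem.** Let $\mathcal R$ be an LCTRS with initial state $(t,\varphi)$. If the judgement $\vdash((t^\sharp,\varphi),\mathsf{DT}(\mathcal R),\mathcal R\cup\mathcal R_{\mathsf{calc}}):(T,S)$ is valid, then for all $\vec m$ $$\mathrm{rc}_{\mathcal R}^{(t,\varphi)}(\vec m)\ \le\ \sum_{\rho\in\mathsf{DT}(\mathcal R)}T(\rho)(\vec m).$$ -/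

import Mathlib

open scoped ENNReal

universe u

namespace LCTRS

/-- The data fixed throughout: sorts, the background theory (carriers, theory symbols and their
interpretation), norms on the carriers, term symbols, and sorted variables.
The value symbols are not listed here: there is exactly one for every element of every carrier,
see `Sym.val`. Thus the theory symbols are the `TheoryFn`s (non-values) and the values. -/
structure Signature where
  /-- sorts occurring in the background theory -/
  TheorySort : Type u
  /-- all other (user-defined) sorts -/
  TermSort : Type u
  /-- the carrier set of each theory sort -/
  Carrier : TheorySort → Type u
  boolSort : TheorySort
  boolEquiv : Carrier boolSort ≃ Bool
  /-- theory symbols that are not values -/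
  TheoryFn : Type u
  fnArity : TheoryFn → ℕ
  fnDom : (g : TheoryFn) → Fin (fnArity g) → TheorySort
  fnCod : TheoryFn → TheorySort
  /-- the fixed interpretation of the theory symbols -/
  fnInterp : (g : TheoryFn) → ((i : Fin (fnArity g)) → Carrier (fnDom g i)) → Carrier (fnCod g)
  /-- the norms that measure the size of values -/
  norm : (ι : TheorySort) → Carrier ι → ℕ
  TermSym : Type u
  symArity : TermSym → ℕ
  symDom : (f : TermSym) → Fin (symArity f) → TheorySort ⊕ TermSort
  symCod : TermSym → TheorySort ⊕ TermSort
  Var : Type u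
  varSort : Var → TheorySort ⊕ TermSort

variable {Sig : Signature.{u}}

/-- Sorts of the signature extended by marked symbols and tuple symbols, which live in a fresh
sort. -/
inductive Srt (Sig : Signature.{u}) : Type u
  | base (s : Sig.TheorySort ⊕ Sig.TermSort)
  | fresh

/-- Function symbols: term symbols, non-value theory symbols, values, and the fresh symbols
(a marked copy of each term symbol, and a tuple symbol for every arity). -/
inductive Sym (Sig : Signature.{u}) : Type u
  | term (f : Sig.TermSym)
  | fn (g : Sig.TheoryFn)
  | val (ι : Sig.TheorySort) (a : Sig.Carrier ι)
  | sharp (f : Sig.TermSym)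
  | tuple (k : ℕ)

namespace Sym

def arity : Sym Sig → ℕ
  | term f => Sig.symArity f
  | fn g => Sig.fnArity g
  | val _ _ => 0
  | sharp f => Sig.symArity f
  | tuple k => k

def dom : (f : Sym Sig) → Fin f.arity → Srt Sig
  | term f => fun i => .base (Sig.symDom f i)
  | fn g => fun i => .base (.inl (Sig.fnDom g i))
  | val _ _ => fun _ => .fresh
  | sharp f => fun i => .base (Sig.symDom f i)
  | tuple _ => fun _ => .fresh

def cod : Sym Sig → Srt Sig
  | term f => .base (Sig.symCod f)
  | fn g => .base (.inl (Sig.fnCod g))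
  | val ι _ => .base (.inl ι)
  | sharp _ => .fresh
  | tuple _ => .fresh

/-- The theory symbols, values included. -/
def IsTheory : Sym Sig → Prop
  | fn _ => True
  | val _ _ => True
  | _ => False

/-- The symbols of the original signature (neither marked symbols nor tuple symbols). -/
def IsBase : Sym Sig → Prop
  | sharp _ => False
  | tuple _ => False
  | _ => True

end Sym

/-- Terms over the extended signature; the arity is built in, sorts are checked by
`Term.WellSorted`. -/
inductive Term (Sig : Signature.{u}) : Type u
  | var (x : Sig.Var)
  | app (f : Sym Sig) (args : Fin f.arity → Term Sig)

namespace Term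

/-- The value `c_a` as a term. -/
def val (ι : Sig.TheorySort) (a : Sig.Carrier ι) : Term Sig :=
  app (Sym.val ι a) Fin.elim0

def IsValue (t : Term Sig) : Prop := ∃ ι a, t = val ι a

/-- The value `true`. -/
def tt (Sig : Signature.{u}) : Term Sig := val Sig.boolSort (Sig.boolEquiv.symm true)

def sort : Term Sig → Srt Sig
  | var x => .base (Sig.varSort x)
  | app f _ => f.cod

def WellSorted : Term Sig → Prop
  | var _ => True
  | app f args => ∀ i, (args i).sort = f.dom i ∧ (args i).WellSorted

def vars : Term Sig → Set Sig.Var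
  | var x => {x}
  | app _ args => ⋃ i, (args i).vars

def syms : Term Sig → Set (Sym Sig)
  | var _ => ∅
  | app f args => {f} ∪ ⋃ i, (args i).syms

open Classical in
/-- Number of occurrences of a variable. -/
noncomputable def count (x : Sig.Var) : Term Sig → ℕ
  | var y => if y = x then 1 else 0
  | app _ args => ∑ i, (args i).count x

def IsTheory (t : Term Sig) : Prop := ∀ f ∈ t.syms, f.IsTheory

def IsBase (t : Term Sig) : Prop := ∀ f ∈ t.syms, f.IsBase

/-- A constraint is a theory term of sort `bool`. -/
def IsConstraint (φ : Term Sig) : Prop :=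
  φ.IsTheory ∧ φ.WellSorted ∧ φ.sort = .base (.inl Sig.boolSort)

/-- `f(t₁,…,tₙ)` becomes `f♯(t₁,…,tₙ)`. (Only used for terms rooted by a term symbol.) -/
def sharp : Term Sig → Term Sig
  | app (.term f) args => app (.sharp f) args
  | t => t

/-- The term `⟨t₁,…,tₖ⟩`. -/
def tuple (l : List (Term Sig)) : Term Sig := app (.tuple l.length) (fun i => l.get i)

end Term

/-- Substitutions: sort-preserving maps from variables to terms with finite domain. -/
structure Subst (Sig : Signature.{u}) where
  toFun : Sig.Var → Term Sig
  wellSorted : ∀ x, (toFun x).WellSorted ∧ (toFun x).sort = .base (Sig.varSort x)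
  finite : {x | toFun x ≠ .var x}.Finite

namespace Term

def subst (σ : Subst Sig) : Term Sig → Term Sig
  | var x => σ.toFun x
  | app f args => app f (fun i => (args i).subst σ)

/-- `Interp t ι a`: the variable-free theory term `t` has sort `ι` and interpretation `a`. -/
inductive Interp : Term Sig → (ι : Sig.TheorySort) → Sig.Carrier ι → Prop
  | val (ι : Sig.TheorySort) (a : Sig.Carrier ι) (args : Fin 0 → Term Sig) :
      Interp (app (Sym.val ι a) args) ι a
  | fn (g : Sig.TheoryFn) (args : Fin (Sig.fnArity g) → Term Sig)
      (a : (i : Fin (Sig.fnArity g)) → Sig.Carrier (Sig.fnDom g i))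
      (h : ∀ i, Interp (args i) (Sig.fnDom g i) (a i)) :
      Interp (app (Sym.fn g) args) (Sig.fnCod g) (Sig.fnInterp g a)

/-- A constraint is valid if it evaluates to true under all valuations. -/
def Valid (φ : Term Sig) : Prop :=
  ∀ γ : Subst Sig, (∀ x ∈ φ.vars, (γ.toFun x).IsValue) →
    Interp (φ.subst γ) Sig.boolSort (Sig.boolEquiv.symm true)

/-- `ProperSubterm s t`: `s` is a proper subterm of `t`. -/
inductive ProperSubterm : Term Sig → Term Sig → Prop
  | arg (f : Sym Sig) (args : Fin f.arity → Term Sig) (i : Fin f.arity) :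
      ProperSubterm (args i) (app f args)
  | deep (s : Term Sig) (f : Sym Sig) (args : Fin f.arity → Term Sig) (i : Fin f.arity)
      (h : ProperSubterm s (args i)) : ProperSubterm s (app f args)

end Term

/-- `σ` respects the constraint `φ`: it maps the variables of `φ` to values, and `φσ` is valid. -/
def Subst.Respects (σ : Subst Sig) (φ : Term Sig) : Prop :=
  (φ.subst σ).Valid ∧ ∀ x ∈ φ.vars, (σ.toFun x).IsValue

/-- A constrained rule `lhs → rhs [con]`. -/
@[ext] structure Rule (Sig : Signature.{u}) where
  lhs : Term Sig
  rhs : Term Sig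
  con : Term Sig

namespace Rule

/-- The well-formedness conditions on a rule of an LCTRS over the original signature,
left-linearity included. -/
structure IsLCTRSRule (ρ : Rule Sig) : Prop where
  lhs_base : ρ.lhs.IsBase
  rhs_base : ρ.rhs.IsBase
  lhs_wellSorted : ρ.lhs.WellSorted
  rhs_wellSorted : ρ.rhs.WellSorted
  same_sort : ρ.lhs.sort = ρ.rhs.sort
  con_constraint : ρ.con.IsConstraint
  root_term : ∃ f args, ρ.lhs = .app (.term f) args
  left_linear : ∀ x, ρ.lhs.count x ≤ 1

/-- `σ` respects the rule `ℓ → r [φ]`: it respects `φ`, and variables that are fresh in `r`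
(not in `ℓ`) are mapped to values. The second condition follows from the first if all
variables of `r` occur in `ℓ` or `φ`. -/
def RespectedBy (ρ : Rule Sig) (σ : Subst Sig) : Prop :=
  σ.Respects ρ.con ∧ ∀ x ∈ ρ.rhs.vars \ ρ.lhs.vars, (σ.toFun x).IsValue

end Rule

/-- `R` is a (left-linear) logically constrained term rewrite system. -/
def IsLCTRS (R : Set (Rule Sig)) : Prop := ∀ ρ ∈ R, ρ.IsLCTRSRule

/-- The calculation rules `f(c₁,…,cₙ) → c` for non-value theory symbols `f`, where `c` is the
value of `f(c₁,…,cₙ)`. -/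
def calcRules (Sig : Signature.{u}) : Set (Rule Sig) :=
  {ρ | ∃ (g : Sig.TheoryFn) (a : (i : Fin (Sig.fnArity g)) → Sig.Carrier (Sig.fnDom g i)),
    ρ = { lhs := .app (.fn g) (fun i => .val (Sig.fnDom g i) (a i))
          rhs := .val (Sig.fnCod g) (Sig.fnInterp g a)
          con := .tt Sig }}

/-- Closure of a relation on terms under contexts. -/
inductive InContext (r : Term Sig → Term Sig → Prop) : Term Sig → Term Sig → Prop
  | here (s t : Term Sig) (h : r s t) : InContext r s t
  | arg (f : Sym Sig) (args : Fin f.arity → Term Sig) (i : Fin f.arity) (t : Term Sig)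
      (h : InContext r (args i) t) :
      InContext r (.app f args) (.app f (Function.update args i t))

/-- The step `s →_ρ t`. -/
def RuleStep (ρ : Rule Sig) : Term Sig → Term Sig → Prop :=
  InContext fun s t => ∃ σ : Subst Sig, ρ.RespectedBy σ ∧
    s = ρ.lhs.subst σ ∧ t = ρ.rhs.subst σ

/-- The relation `→_calc`. -/
def CalcStep (s t : Term Sig) : Prop := ∃ ρ ∈ calcRules Sig, RuleStep ρ s t

/-- The relation `→_R`, which includes the calculation steps. -/
def Step (R : Set (Rule Sig)) (s t : Term Sig) : Prop :=
  CalcStep s t ∨ ∃ ρ ∈ R, RuleStep ρ s t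

def IsNF (R : Set (Rule Sig)) (t : Term Sig) : Prop := ¬ ∃ t', Step R t t'

/-- The innermost step with rule `ρ` and substitution `σ`, where `R` is the ambient system
that determines the normal forms. -/
def InnermostStepWith (R : Set (Rule Sig)) (ρ : Rule Sig) (σ : Subst Sig) :
    Term Sig → Term Sig → Prop :=
  InContext fun s t => ρ.RespectedBy σ ∧ s = ρ.lhs.subst σ ∧ t = ρ.rhs.subst σ ∧
    ∀ u, Term.ProperSubterm u s → IsNF R u

/-- The innermost step with rule `ρ`, for the ambient system `R`. -/
def InnermostStep (R : Set (Rule Sig)) (ρ : Rule Sig) (s t : Term Sig) : Prop :=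
  ∃ σ, InnermostStepWith R ρ σ s t

/-- An innermost step with some rule in `A`, calculation steps not included. -/
def InnermostRuleStep (R A : Set (Rule Sig)) (s t : Term Sig) : Prop :=
  ∃ ρ ∈ A, InnermostStep R ρ s t

/-- The innermost rewrite relation of `R`, calculation steps included. -/
def InnermostRewrite (R : Set (Rule Sig)) (s t : Term Sig) : Prop :=
  CalcStep s t ∨ InnermostRuleStep R R s t

/-- The relation `A/B`, that is `B* · A · B*`. -/
def Relative (A B : Term Sig → Term Sig → Prop) (s t : Term Sig) : Prop :=
  ∃ s' t', Relation.ReflTransGen B s s' ∧ A s' t' ∧ Relation.ReflTransGen B t' t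

/-- Derivation height of a term with respect to a relation. -/
noncomputable def dh (t : Term Sig) (r : Term Sig → Term Sig → Prop) : ℕ∞ :=
  sSup {n : ℕ∞ | ∃ k : ℕ, n = k ∧ ∃ s : ℕ → Term Sig, s 0 = t ∧ ∀ i < k, r (s i) (s (i + 1))}

/-- `σ` respects `φ`, maps every variable `x` of `t` to a value, and the size of that value is at
most `m x`: the condition `|x⃗σ| ≤ m⃗` on instances of the constrained term `(t, φ)`, with the
vector `m⃗` indexed by the variables of `t`. -/
def Admissible (t φ : Term Sig) (m : t.vars → ℕ) (σ : Subst Sig) : Prop :=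
  σ.Respects φ ∧ ∀ x : t.vars, ∃ ι a, σ.toFun x = .val ι a ∧ Sig.norm ι a ≤ m x

/-- The innermost runtime complexity of `R` for the constrained term `(t, φ)`: the relation
counted is that of rule steps of `R` modulo calculation steps. -/
noncomputable def rc (R : Set (Rule Sig)) (t φ : Term Sig) (m : t.vars → ℕ) : ℕ∞ :=
  sSup {n | ∃ σ, Admissible t φ m σ ∧
    n = dh (t.subst σ) (Relative (InnermostRuleStep R R) CalcStep)}

/-- `(t, φ)` is an initial state for `R`: `t = init(x₁,…,xₙ)` for variables `xᵢ` and a term symbol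
`init` that occurs in no right-hand side, and `φ` is a constraint. -/
def IsInitialState (R : Set (Rule Sig)) (t φ : Term Sig) : Prop :=
  φ.IsConstraint ∧ t.WellSorted ∧
    ∃ (f : Sig.TermSym) (x : Fin (Sig.symArity f) → Sig.Var),
      t = .app (.term f) (fun i => .var (x i)) ∧ ∀ ρ ∈ R, Sym.term f ∉ ρ.rhs.syms

/-- The defined symbols of `R`. -/
def definedSyms (R : Set (Rule Sig)) : Set (Sym Sig) :=
  {f | ∃ ρ ∈ R, ∃ args, ρ.lhs = .app f args}

open Classical in
/-- The subterms of a term at the positions carrying a symbol in `F`, one entry for each such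
position, in the lexicographic order of positions. -/
noncomputable def Term.subtermsRootedIn (F : Set (Sym Sig)) : Term Sig → List (Term Sig)
  | .var _ => []
  | .app f args =>
      (if f ∈ F then [.app f args] else []) ++
        (List.ofFn fun i => (args i).subtermsRootedIn F).flatten

/-- The dependency tuple of a rule `ρ` of `R`. -/
noncomputable def dependencyTuple (R : Set (Rule Sig)) (ρ : Rule Sig) : Rule Sig where
  lhs := ρ.lhs.sharp
  rhs := .tuple ((ρ.rhs.subtermsRootedIn (definedSyms R)).map Term.sharp)
  con := ρ.con

/-- The set `DT(R)`. -/
def DT (R : Set (Rule Sig)) : Set (Rule Sig) := dependencyTuple R '' R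

/-- Bound expressions. -/
inductive UB (Sig : Signature.{u}) : Type u
  | size (x : Sig.Var)
  | int (z : ℤ)
  | omega
  | add (p q : UB Sig)
  | mul (p q : UB Sig)
  | max (p q : UB Sig)
  | pow (k : ℕ) (p : UB Sig)
  | div (p : UB Sig) (k : ℕ)
  | log (k : ℕ) (p : UB Sig)

open Classical in
/-- The value of a bound expression in the extended reals when `|x|` has the value `m x`.
Undefined operations (division by zero, a negative power of zero, a logarithm to base zero or one,
or of a negative number) yield `-∞`, which is an upper bound for nothing of interest. -/
noncomputable def UB.eval (m : Sig.Var → ℕ) : UB Sig → EReal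
  | size x => ((m x : ℝ) : EReal)
  | int z => ((z : ℝ) : EReal)
  | omega => ⊤
  | add p q => p.eval m + q.eval m
  | mul p q => p.eval m * q.eval m
  | max p q => Max.max (p.eval m) (q.eval m)
  | pow k p =>
      if k = 0 then
        if 0 < p.eval m then 0 else if p.eval m = 0 then 1 else ⊥
      else ((EReal.exp (p.eval m * ((Real.log k : ℝ) : EReal)) : ℝ≥0∞) : EReal)
  | div p k => if k = 0 then ⊥ else p.eval m / ((k : ℝ) : EReal)
  | log k p =>
      if k ≤ 1 ∨ p.eval m < 0 then ⊥
      else ENNReal.log (p.eval m).toENNReal / ((Real.log k : ℝ) : EReal)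

/-- A complexity problem `((t, φ), D, R)`. -/
structure Problem (Sig : Signature.{u}) where
  t : Term Sig
  φ : Term Sig
  D : Set (Rule Sig)
  R : Set (Rule Sig)

namespace Problem

/-- The entry variables of a problem. -/
def EV (P : Problem Sig) : Type u :=
  {p : Rule Sig × Sig.Var // p.1 ∈ P.D ∧ p.2 ∈ p.1.lhs.vars}

/-- Runtime approximations: `T ρ` bounds the number of `ρ`-steps in innermost `D ∪ R` rewrite
sequences from admissible instances of the initial term. The assignment `m` ranges over all
variables; it restricts to the vector of input sizes, and assigns arbitrary numbers to all other
variables that may occur in `T ρ`. -/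
def IsRuntimeApprox (P : Problem Sig) (T : P.D → UB Sig) : Prop :=
  ∀ (ρ : P.D) (m : Sig.Var → ℕ),
    (((sSup {n | ∃ σ, Admissible P.t P.φ (fun x => m x) σ ∧
        n = dh (P.t.subst σ) (Relative (InnermostRuleStep (P.D ∪ P.R) {ρ.1})
          (InnermostRewrite (P.D ∪ P.R)))} : ℕ∞) : ℝ≥0∞) : EReal) ≤ (T ρ).eval m

/-- Size approximations: `S (ρ, y)` bounds the sizes of the values substituted for `y` when `ρ` is
applied in an innermost rewrite sequence from an admissible instance of the initial term. -/
def IsSizeApprox (P : Problem Sig) (S : P.EV → UB Sig) : Prop :=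
  ∀ (e : P.EV) (m : Sig.Var → ℕ),
    (((sSup {n : ℕ∞ | ∃ (σ τ : Subst Sig) (s u : Term Sig) (ι : Sig.TheorySort)
          (a : Sig.Carrier ι),
        Admissible P.t P.φ (fun x => m x) σ ∧
        Relation.ReflTransGen (InnermostRewrite (P.R ∪ P.D)) (P.t.subst σ) s ∧
        InnermostStepWith (P.R ∪ P.D) e.1.1 τ s u ∧
        τ.toFun e.1.2 = .val ι a ∧ n = Sig.norm ι a} : ℕ∞) : ℝ≥0∞) : EReal) ≤ (S e).eval m

/-- The judgement `⊢ P : (T, S)` is valid: `(T, S)` is a bound approximation for `P`. -/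
def ValidJudgement (P : Problem Sig) (T : P.D → UB Sig) (S : P.EV → UB Sig) : Prop :=
  P.IsRuntimeApprox T ∧ P.IsSizeApprox S

end Problem

/-- The problem `((t♯, φ), DT(R), R ∪ R_calc)`. -/
def dtProblem (R : Set (Rule Sig)) (t φ : Term Sig) : Problem Sig where
  t := t.sharp
  φ := φ
  D := DT R
  R := R ∪ calcRules Sig

end LCTRS

/-! A derivation of `R` is simulated by one of the extended system in which each rule step uses
exactly one dependency tuple. The simulating term `U` is a tree of tuple symbols with marked terms
as leaves. The invariant is that the active subterms of the current term `s` (defined root, not in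
normal form) form a sub-multiset of the unmarked leaves of `U`. Every occurrence that may still be
rewritten at its root thus owns a private copy in `U`.

When a redex in `s` is contracted, each active subterm properly above it is updated by the same step
inside its copy. The redex is active too, so it owns a leaf, and the dependency tuple of the rule is
applied there. Since the step is innermost, the matching substitution sends the variables of the
right-hand side to normal forms. All active subterms of the contractum therefore come from positions
of defined symbols in the right-hand side, and these are what the tuple lists
(`Term.activeSubterms_subst_le`). The context argument is `InContext.simulate`, and its two
instances are `CalcStep.simulate` and `InnermostStep.simulate`.

The inequality between multisets is essential: an updated ancestor may become a normal form while
its copy stays in `U`. Terms in the original derivation contain no marked symbols, so the dependency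
tuples do not affect which of their subterms are normal forms.

A derivation with `k` rule steps thus yields `k` tuple applications in a single simulating
derivation. For each tuple `d`, all other steps are absorbed into the relative relation, so `d`
occurs at most `T d` times; summing over `d` bounds `k`. -/

namespace LCTRS

variable {Sig : Signature.{u}}

/-! ### Leaves and active subterms -/

namespace Term

/-- The unmarked versions of the marked subterms of a term that lie below tuple symbols only. -/
noncomputable def leaves : Term Sig → Multiset (Term Sig)
  | var _ => 0
  | app (.sharp f) args => {app (.term f) args}
  | app (.tuple _) args => ∑ i, (args i).leaves
  | app _ _ => 0

open Classical in
/-- The subterms with a defined root that are not in normal form. -/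
noncomputable def activeSubterms (R : Set (Rule Sig)) : Term Sig → Multiset (Term Sig)
  | var _ => 0
  | app f args =>
      (if f ∈ definedSyms R ∧ ¬ IsNF R (app f args) then {app f args} else 0) +
        ∑ i, (args i).activeSubterms R

@[simp] theorem leaves_sharp (f : Sig.TermSym) (args : Fin (Sym.sharp f).arity → Term Sig) :
    (app (.sharp f) args).leaves = {app (.term f) args} := by
  simp [leaves]

@[simp] theorem leaves_tuple (k : ℕ) (args : Fin (Sym.tuple k).arity → Term Sig) :
    (app (.tuple k) args).leaves = ∑ i, (args i).leaves := by
  simp [leaves]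

/-- The context `C` is the path through tuple symbols to one chosen occurrence of the leaf. The
replaced leaf is added on the left because this avoids subtraction of multisets. -/
theorem exists_context_of_mem_leaves (u : Term Sig) : ∀ U : Term Sig, u ∈ U.leaves →
    ∃ C : Term Sig → Term Sig,
      (∀ r W, InContext r u.sharp W → InContext r U (C W)) ∧
      ∀ W, (C W).leaves + {u} = U.leaves + W.leaves
  | var _, h => by simp [leaves] at h
  | app (.term _) _, h => by simp [leaves] at h
  | app (.fn _) _, h => by simp [leaves] at h
  | app (.val _ _) _, h => by simp [leaves] at h
  | app (.sharp f) args, h => by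
      obtain rfl : u = app (.term f) args := by simpa [leaves] using h
      refine ⟨id, fun r W hW => hW, fun W => ?_⟩
      rw [leaves_sharp, id, add_comm]
  | app (.tuple k) args, h => by
      obtain ⟨i, hi⟩ : ∃ i, u ∈ (args i).leaves := by
        rw [leaves_tuple] at h
        simpa [Multiset.mem_sum] using h
      obtain ⟨C, hC, hl⟩ := exists_context_of_mem_leaves u (args i) hi
      refine ⟨fun W => app (.tuple k) (Function.update args i (C W)),
        fun r W hW => .arg _ _ _ _ (hC r W hW), fun W => ?_⟩
      have h1 : ∑ j ∈ Finset.univ.erase i, (Function.update args i (C W) j).leaves =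
          ∑ j ∈ Finset.univ.erase i, (args j).leaves :=
        Finset.sum_congr rfl fun j hj => by
          rw [Function.update_of_ne (Finset.ne_of_mem_erase hj)]
      rw [leaves_tuple, leaves_tuple, ← Finset.add_sum_erase _ _ (Finset.mem_univ i), h1,
        ← Finset.add_sum_erase _ (fun j => (args j).leaves) (Finset.mem_univ i),
        Function.update_self, add_right_comm, hl W, add_right_comm]

end Term

/-! ### Steps in contexts and normal forms -/

theorem InContext.mono {r r' : Term Sig → Term Sig → Prop} (h : ∀ s t, r s t → r' s t)
    {s t : Term Sig} (hst : InContext r s t) : InContext r' s t := by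
  induction hst with
  | here s t hr => exact .here _ _ (h _ _ hr)
  | arg f args i t _ ih => exact .arg _ _ _ _ ih

theorem Step.arg {R : Set (Rule Sig)} (f : Sym Sig) (args : Fin f.arity → Term Sig)
    (i : Fin f.arity) {t : Term Sig} (h : Step R (args i) t) :
    Step R (.app f args) (.app f (Function.update args i t)) := by
  rcases h with ⟨ρ, hρ, h⟩ | ⟨ρ, hρ, h⟩
  · exact .inl ⟨ρ, hρ, .arg _ _ _ _ h⟩
  · exact .inr ⟨ρ, hρ, .arg _ _ _ _ h⟩

theorem IsNF.arg {R : Set (Rule Sig)} {f : Sym Sig} {args : Fin f.arity → Term Sig}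
    (h : IsNF R (.app f args)) (i : Fin f.arity) : IsNF R (args i) :=
  fun ⟨_, ht⟩ => h ⟨_, ht.arg f args i⟩

theorem Term.activeSubterms_eq_zero {R : Set (Rule Sig)} {s : Term Sig} (h : IsNF R s) :
    s.activeSubterms R = 0 := by
  induction s with
  | var x => rfl
  | app f args ih =>
    rw [activeSubterms, if_neg (fun h' => h'.2 h), zero_add]
    exact Finset.sum_eq_zero fun i _ => ih i (h.arg i)

/-! ### Terms without marked or tuple symbols -/

namespace Term

@[simp] theorem isBase_app {f : Sym Sig} {args : Fin f.arity → Term Sig} :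
    (app f args).IsBase ↔ f.IsBase ∧ ∀ i, (args i).IsBase := by
  simp only [IsBase, syms]
  constructor
  · exact fun h => ⟨h f (by simp), fun i g hg => h g (by simp; exact .inr ⟨i, hg⟩)⟩
  · rintro ⟨h1, h2⟩ g hg
    simp only [Set.singleton_union, Set.mem_insert_iff, Set.mem_iUnion] at hg
    rcases hg with rfl | ⟨i, hi⟩
    · exact h1
    · exact h2 i g hi

theorem isBase_of_isValue {t : Term Sig} (h : t.IsValue) : t.IsBase := by
  obtain ⟨ι, a, rfl⟩ := h
  exact isBase_app.2 ⟨trivial, fun i => i.elim0⟩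

theorem IsBase.of_subst {σ : Subst Sig} {t : Term Sig} (h : (t.subst σ).IsBase)
    {x : Sig.Var} (hx : x ∈ t.vars) : (σ.toFun x).IsBase := by
  induction t with
  | var y => obtain rfl : x = y := hx; exact h
  | app f args ih =>
    obtain ⟨i, hi⟩ := Set.mem_iUnion.1 hx
    exact ih i ((isBase_app.1 h).2 i) hi

theorem IsBase.subst {σ : Subst Sig} {t : Term Sig} (h : t.IsBase)
    (hσ : ∀ x ∈ t.vars, (σ.toFun x).IsBase) : (t.subst σ).IsBase := by
  induction t with
  | var y => exact hσ y rfl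
  | app f args ih =>
    rw [isBase_app] at h
    exact isBase_app.2 ⟨h.1, fun i => ih i (h.2 i) fun x hx => hσ x (Set.mem_iUnion.2 ⟨i, hx⟩)⟩

theorem IsBase.properSubterm {s t : Term Sig} (h : ProperSubterm s t) (ht : t.IsBase) :
    s.IsBase := by
  induction h with
  | arg f args i => exact (isBase_app.1 ht).2 i
  | deep s f args i _ ih => exact ih ((isBase_app.1 ht).2 i)

end Term

theorem IsLCTRS.exists_term_of_mem_definedSyms {R : Set (Rule Sig)} (hR : IsLCTRS R)
    {f : Sym Sig} (hf : f ∈ definedSyms R) : ∃ g, f = .term g := by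
  obtain ⟨ρ, hρ, args, h⟩ := hf
  obtain ⟨g, args', h'⟩ := (hR ρ hρ).root_term
  rw [h] at h'
  exact ⟨g, (Term.app.inj h').1⟩

/-- Variables of the left-hand side are bound to subterms of the redex, and the remaining ones to
values, so no fresh symbol can enter. -/
theorem RuleStep.isBase {ρ : Rule Sig} (hr : ρ.rhs.IsBase) {s t : Term Sig}
    (h : RuleStep ρ s t) (hs : s.IsBase) : t.IsBase := by
  induction h with
  | here s t h =>
    obtain ⟨σ, hσ, rfl, rfl⟩ := h
    refine hr.subst fun x hx => ?_
    by_cases hl : x ∈ ρ.lhs.vars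
    · exact hs.of_subst hl
    · exact Term.isBase_of_isValue (hσ.2 x ⟨hx, hl⟩)
  | arg f args i t _ ih =>
    rw [Term.isBase_app] at hs ⊢
    refine ⟨hs.1, fun j => ?_⟩
    by_cases hj : j = i
    · subst hj; simpa using ih (hs.2 j)
    · simpa [hj] using hs.2 j

theorem CalcStep.isBase {s t : Term Sig} (h : CalcStep s t) (hs : s.IsBase) : t.IsBase := by
  obtain ⟨ρ, ⟨g, a, rfl⟩, h⟩ := h
  exact RuleStep.isBase (Term.isBase_of_isValue ⟨_, _, rfl⟩) h hs

theorem InnermostStepWith.ruleStep {R : Set (Rule Sig)} {ρ : Rule Sig} {σ : Subst Sig}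
    {s t : Term Sig} (h : InnermostStepWith R ρ σ s t) : RuleStep ρ s t :=
  h.mono fun _ _ h => ⟨σ, h.1, h.2.1, h.2.2.1⟩

/-- No rule with a marked left-hand side applies to a term without marked symbols. -/
theorem Term.IsBase.not_ruleStep {ρ : Rule Sig} {f : Sig.TermSym}
    {args : Fin (Sig.symArity f) → Term Sig} (hl : ρ.lhs = .app (.sharp f) args)
    {s t : Term Sig} (hs : s.IsBase) : ¬ RuleStep ρ s t := by
  intro h
  induction h with
  | here s t h =>
    obtain ⟨σ, -, rfl, -⟩ := h
    rw [hl] at hs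
    exact (Term.isBase_app.1 hs).1
  | arg f args i t _ ih => exact ih ((Term.isBase_app.1 hs).2 i)

/-! ### Normal forms of the original and the extended system -/

/-- Left-hand sides of dependency tuples have a marked root, which does not occur in `s`; the
calculation rules are already part of `Step R`. -/
theorem IsNF.union_DT {R : Set (Rule Sig)} (hR : IsLCTRS R) {s : Term Sig} (hs : s.IsBase)
    (h : IsNF R s) : IsNF (DT R ∪ (R ∪ calcRules Sig)) s := by
  rintro ⟨t, ht | ⟨ρ, (⟨ρ', hρ', rfl⟩ | hρ | hρ), ht⟩⟩
  · exact h ⟨t, .inl ht⟩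
  · obtain ⟨f, args, hf⟩ := (hR ρ' hρ').root_term
    exact hs.not_ruleStep (ρ := dependencyTuple R ρ') (f := f) (args := args)
      (by simp [dependencyTuple, hf, Term.sharp]) ht
  · exact h ⟨t, .inr ⟨ρ, hρ, ht⟩⟩
  · exact h ⟨t, .inl ⟨ρ, hρ, ht⟩⟩

/-- Left-hand sides are rooted by term symbols or non-value theory symbols, and a value has no
argument in which to rewrite. -/
theorem Term.isNF_of_isValue {R : Set (Rule Sig)} (hR : IsLCTRS R) {s : Term Sig}
    (hs : s.IsValue) : IsNF R s := by
  obtain ⟨ι, a, rfl⟩ := hs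
  have key : ∀ (ρ : Rule Sig) (f : Sym Sig) (args : Fin f.arity → Term Sig),
      ρ.lhs = .app f args → (∀ ι a, f ≠ .val ι a) → ∀ t, ¬ RuleStep ρ (.val ι a) t := by
    intro ρ f args hl hf t ht
    generalize hv : Term.val ι a = v at ht
    cases ht with
    | here s t h =>
      obtain ⟨σ, -, h, -⟩ := h
      rw [hl, ← hv] at h
      exact hf _ _ (Term.app.inj h).1.symm
    | arg g args i t h =>
      obtain rfl := (Term.app.inj hv).1
      exact i.elim0
  rintro ⟨t, ⟨ρ, ⟨g, b, rfl⟩, ht⟩ | ⟨ρ, hρ, ht⟩⟩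
  · exact key _ (.fn g) _ rfl (by simp) _ ht
  · obtain ⟨f, args, hf⟩ := (hR ρ hρ).root_term
    exact key _ _ _ hf (by simp) _ ht

/-- A variable of a term rooted by a function symbol is instantiated to a proper subterm. -/
theorem Term.isNF_of_mem_vars {R : Set (Rule Sig)} {σ : Subst Sig} {f : Sym Sig}
    {args : Fin f.arity → Term Sig} (h : ∀ i, IsNF R ((args i).subst σ))
    {x : Sig.Var} (hx : x ∈ (app f args).vars) : IsNF R (σ.toFun x) := by
  have key : ∀ t : Term Sig, IsNF R (t.subst σ) → x ∈ t.vars → IsNF R (σ.toFun x) := by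
    intro t
    induction t with
    | var y => intro h hx; obtain rfl : x = y := hx; exact h
    | app f args ih =>
      intro h hx
      obtain ⟨i, hi⟩ := Set.mem_iUnion.1 hx
      exact ih i (IsNF.arg (f := f) (args := fun i => (args i).subst σ) h i) hi
  obtain ⟨i, hi⟩ := Set.mem_iUnion.1 hx
  exact key _ (h i) hi

/-! ### Simulation of a step inside a context -/

/-- The system `DT(R) ∪ R ∪ R_calc`. -/
def dtSystem (R : Set (Rule Sig)) : Set (Rule Sig) := DT R ∪ (R ∪ calcRules Sig)

theorem InnermostRewrite.inContext {R : Set (Rule Sig)} {s t : Term Sig}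
    (h : InContext (InnermostRewrite R) s t) : InnermostRewrite R s t := by
  induction h with
  | here s t h => exact h
  | arg f args i t _ ih =>
    rcases ih with ⟨ρ, hρ, h⟩ | ⟨ρ, hρ, σ, h⟩
    · exact .inl ⟨ρ, hρ, .arg _ _ _ _ h⟩
    · exact .inr ⟨ρ, hρ, σ, .arg _ _ _ _ h⟩

/-- A step of a term `s` is simulated by a term that has all active subterms of `s` as leaves:
first the step is performed in the copies that contain the redex properly, and then the redex itself
is taken care of. -/
theorem InContext.simulate {R : Set (Rule Sig)} (hR : IsLCTRS R)
    {r A B : Term Sig → Term Sig → Prop}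
    (hnf : ∀ s t, InContext r s t → ¬ IsNF R s)
    (hB : ∀ s t, InContext B s t → B s t)
    (hrB : ∀ s t, s.IsBase → InContext r s t → B s t)
    (htop : ∀ s t M U, r s t → s.IsBase → s.activeSubterms R + M ≤ U.leaves →
      ∃ U', A U U' ∧ t.activeSubterms R + M ≤ U'.leaves)
    {s t : Term Sig} (h : InContext r s t) (hs : s.IsBase) (M : Multiset (Term Sig)) (U : Term Sig)
    (hU : s.activeSubterms R + M ≤ U.leaves) :
    ∃ V U', Relation.ReflTransGen B U V ∧ A V U' ∧ t.activeSubterms R + M ≤ U'.leaves := by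
  induction h generalizing M U with
  | here s t h =>
    obtain ⟨U', h1, h2⟩ := htop s t M U h hs hU
    exact ⟨U, U', .refl, h1, h2⟩
  | arg f args i t h ih =>
    have hi := (Term.isBase_app.1 hs).2 i
    have hrest : ∑ j ∈ Finset.univ.erase i,
        (Function.update args i t j).activeSubterms R =
        ∑ j ∈ Finset.univ.erase i, (args j).activeSubterms R :=
      Finset.sum_congr rfl fun j hj => by
        rw [Function.update_of_ne (Finset.ne_of_mem_erase hj)]
    rw [Term.activeSubterms, ← Finset.add_sum_erase _ _ (Finset.mem_univ i)] at hU
    rw [Term.activeSubterms, ← Finset.add_sum_erase _ _ (Finset.mem_univ i), hrest,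
      Function.update_self]
    set N := ∑ j ∈ Finset.univ.erase i, (args j).activeSubterms R
    by_cases hf : f ∈ definedSyms R
    · obtain ⟨g, rfl⟩ := hR.exists_term_of_mem_definedSyms hf
      -- An ancestor of the redex is not a normal form; with a defined root it is active and so owns
      -- a leaf of `U`.
      rw [if_pos ⟨hf, hnf _ _ (.arg _ _ _ _ h)⟩] at hU
      have hmem : Term.app (.term g) args ∈ U.leaves :=
        Multiset.mem_of_le hU (by simp)
      obtain ⟨C, hC, hl⟩ := Term.exists_context_of_mem_leaves _ U hmem
      set W : Term Sig := .app (.sharp g) (Function.update args i t)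
      have hUW : B U (C W) := hB _ _ (hC _ _ (.arg (.sharp g) args i t (.here _ _ (hrB _ _ hi h))))
      -- The frame for the induction hypothesis collects everything outside the `i`-th argument: the
      -- updated ancestor, the siblings, and the old frame `M`.
      have hle : (args i).activeSubterms R +
          ({Term.app (.term g) (Function.update args i t)} + N + M) ≤ (C W).leaves := by
        rw [← add_le_add_iff_right {Term.app (.term g) args}, hl, Term.leaves_sharp]
        refine le_trans (le_of_eq ?_) (add_le_add_left hU _)
        change _ = _ + {Term.app (.term g) (Function.update args i t)}
        abel
      obtain ⟨V, U', h1, h2, h3⟩ := ih hi _ _ hle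
      refine ⟨V, U', .head hUW h1, h2, le_trans ?_ h3⟩
      refine le_trans (b := {Term.app (.term g) (Function.update args i t)} +
        (t.activeSubterms R + N) + M) ?_ (le_of_eq (by abel))
      gcongr
      -- The updated ancestor may now be a normal form, in which case its copy is a surplus leaf.
      split_ifs <;> simp
    · rw [if_neg (fun h' => hf h'.1), zero_add] at hU
      rw [if_neg (fun h' => hf h'.1), zero_add]
      rw [add_assoc] at hU
      obtain ⟨V, U', h1, h2, h3⟩ := ih hi _ _ hU
      exact ⟨V, U', h1, h2, by rwa [add_assoc]⟩

/-- Only the copies of the ancestors need updating. The contractum is a value and has no active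
subterms, so nothing happens at the redex itself and `A` is equality. -/
theorem CalcStep.simulate {R : Set (Rule Sig)} (hR : IsLCTRS R) {s t : Term Sig}
    (h : CalcStep s t) (hs : s.IsBase) {U : Term Sig} (hU : s.activeSubterms R ≤ U.leaves) :
    ∃ U', Relation.ReflTransGen (InnermostRewrite (dtSystem R)) U U' ∧
      t.activeSubterms R ≤ U'.leaves := by
  obtain ⟨ρ, ⟨g, a, rfl⟩, h⟩ := h
  have hcalc : ∀ s t, RuleStep ⟨.app (.fn g) fun i => .val (Sig.fnDom g i) (a i),
      .val (Sig.fnCod g) (Sig.fnInterp g a), .tt Sig⟩ s t → CalcStep s t :=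
    fun s t h => ⟨_, ⟨g, a, rfl⟩, h⟩
  obtain ⟨V, U', h1, rfl, h2⟩ := h.simulate (A := Eq) (B := InnermostRewrite (dtSystem R)) hR
    (fun s t h hn => hn ⟨t, .inl (hcalc _ _ h)⟩)
    (fun s t => InnermostRewrite.inContext) (fun s t _ h => .inl (hcalc _ _ h))
    (fun s t M U h _ hU => by
      obtain ⟨σ, -, -, rfl⟩ := h
      refine ⟨U, rfl, ?_⟩
      rw [Term.activeSubterms_eq_zero, zero_add]
      · exact le_trans (by simp) hU
      · refine Term.isNF_of_isValue hR ⟨Sig.fnCod g, Sig.fnInterp g a, ?_⟩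
        exact congrArg (Term.app _) (funext fun i => Fin.elim0 i))
    hs 0 U (by simpa using hU)
  exact ⟨V, h1, by simpa using h2⟩

/-! ### Dependency tuples and the rewriting of a redex -/

namespace Term

theorem vars_sharp (t : Term Sig) : t.sharp.vars = t.vars := by
  unfold sharp
  split <;> rfl

theorem sharp_subst {f : Sig.TermSym} (args : Fin (Sym.term f).arity → Term Sig) (σ : Subst Sig) :
    (app (.term f) args).sharp.subst σ = ((app (.term f) args).subst σ).sharp := rfl

theorem ProperSubterm.of_sharp {s : Term Sig} {f : Sig.TermSym}
    {args : Fin (Sym.term f).arity → Term Sig} (h : ProperSubterm s (app (.term f) args).sharp) :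
    ProperSubterm s (app (.term f) args) := by
  change ProperSubterm s (app (.sharp f) args) at h
  cases h with
  | arg f args i => exact .arg (.term _) args i
  | deep s f args i h => exact .deep _ (.term _) args i h

theorem vars_subset_of_mem_subtermsRootedIn {F : Set (Sym Sig)} {s t : Term Sig}
    (h : s ∈ t.subtermsRootedIn F) : s.vars ⊆ t.vars := by
  induction t with
  | var x => simp [subtermsRootedIn] at h
  | app f args ih =>
    rw [subtermsRootedIn, List.mem_append] at h
    rcases h with h | h
    · split_ifs at h
      · rw [List.mem_singleton.1 h]
      · simp at h
    · simp only [List.mem_flatten, List.mem_ofFn] at h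
      obtain ⟨_, ⟨i, rfl⟩, h⟩ := h
      exact (ih i h).trans (Set.subset_iUnion (fun i => (args i).vars) i)

theorem vars_tuple_subset {l : List (Term Sig)} {X : Set Sig.Var} (h : ∀ t ∈ l, t.vars ⊆ X) :
    (tuple l).vars ⊆ X :=
  Set.iUnion_subset fun _ => h _ (List.get_mem _ _)

theorem leaves_tuple_subst (l : List (Term Sig)) (σ : Subst Sig) :
    ((tuple l).subst σ).leaves = (l.map fun t => (t.subst σ).leaves).sum := by
  rw [tuple, subst, leaves_tuple]
  exact (Fin.sum_univ_fun_getElem l fun t => (t.subst σ).leaves)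

/-- Normal forms substituted for variables contribute no active subterms, so each active subterm
sits at a position of `t` with a defined symbol. Some of these positions may become normal forms,
hence only an inequality. -/
theorem activeSubterms_subst_le {R : Set (Rule Sig)} (hR : IsLCTRS R) {σ : Subst Sig}
    {t : Term Sig} (h : ∀ x ∈ t.vars, IsNF R (σ.toFun x)) :
    (t.subst σ).activeSubterms R ≤
      ((t.subtermsRootedIn (definedSyms R)).map fun s => (s.sharp.subst σ).leaves).sum := by
  induction t with
  | var x =>
    rw [subst, activeSubterms_eq_zero (h x rfl)]
    simp
  | app f args ih =>
    rw [subst, activeSubterms, subtermsRootedIn, List.map_append, List.sum_append]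
    refine add_le_add ?_ ?_
    · by_cases hf : f ∈ definedSyms R
      · obtain ⟨g, rfl⟩ := hR.exists_term_of_mem_definedSyms hf
        rw [if_pos hf, List.map_singleton, List.sum_singleton]
        change _ ≤ leaves (app (.sharp g) fun i => (args i).subst σ)
        rw [leaves_sharp]
        split_ifs
        · exact le_rfl
        · simp
      · rw [if_neg (fun h' => hf h'.1)]
        simp
    · rw [List.map_flatten, List.sum_flatten, List.map_map, List.map_ofFn, List.sum_ofFn]
      exact Finset.sum_le_sum fun i _ => ih i fun x hx => h x (Set.mem_iUnion.2 ⟨i, hx⟩)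

end Term

/-- Marking keeps variables, and the tuple only contains subterms of the right-hand side, so it has
no new fresh variables. -/
theorem Rule.RespectedBy.dependencyTuple {ρ : Rule Sig} {σ : Subst Sig} (h : ρ.RespectedBy σ)
    (R : Set (Rule Sig)) : (dependencyTuple R ρ).RespectedBy σ := by
  refine ⟨h.1, fun x hx => h.2 x ⟨?_, ?_⟩⟩
  · refine Term.vars_tuple_subset ?_ hx.1
    simp only [List.mem_map]
    rintro _ ⟨s, hs, rfl⟩
    rw [Term.vars_sharp]
    exact Term.vars_subset_of_mem_subtermsRootedIn hs
  · have := hx.2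
    rwa [LCTRS.dependencyTuple, Term.vars_sharp] at this

theorem InnermostStep.simulate {R : Set (Rule Sig)} (hR : IsLCTRS R) {ρ : Rule Sig} (hρ : ρ ∈ R)
    {s t : Term Sig} (h : InnermostStep R ρ s t) (hs : s.IsBase) {U : Term Sig}
    (hU : s.activeSubterms R ≤ U.leaves) :
    ∃ V U', Relation.ReflTransGen (InnermostRewrite (dtSystem R)) U V ∧
      InnermostStep (dtSystem R) (dependencyTuple R ρ) V U' ∧ t.activeSubterms R ≤ U'.leaves := by
  obtain ⟨σ, h⟩ := h
  have hnf : ∀ s t, InnermostStepWith R ρ σ s t → ¬ IsNF R s :=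
    fun s t h hn => hn ⟨t, .inr ⟨ρ, hρ, h.ruleStep⟩⟩
  -- For terms without marked symbols, the innermost condition for `R` carries over to the extended
  -- system.
  have hsub : ∀ s : Term Sig, s.IsBase → (∀ u, Term.ProperSubterm u s → IsNF R u) →
      ∀ u, Term.ProperSubterm u s → IsNF (dtSystem R) u :=
    fun s hs h u hu => (h u hu).union_DT hR (hs.properSubterm hu)
  have hrew : ∀ s t, s.IsBase → InnermostStepWith R ρ σ s t →
      InnermostRewrite (dtSystem R) s t := by
    intro s t hs h
    refine .inr ⟨ρ, .inr (.inl hρ), σ, ?_⟩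
    induction h with
    | here s t h => exact .here _ _ ⟨h.1, h.2.1, h.2.2.1, hsub s hs h.2.2.2⟩
    | arg f args i t _ ih => exact .arg _ _ _ _ (ih ((Term.isBase_app.1 hs).2 i))
  have key := InContext.simulate (A := InnermostStep (dtSystem R) (dependencyTuple R ρ))
    (B := InnermostRewrite (dtSystem R)) hR hnf (fun s t => InnermostRewrite.inContext) hrew
    (fun s t M U h hs hU => ?_) h hs 0 U (by simpa using hU)
  · simpa using key
  · have hns := hnf s t (.here _ _ h)
    obtain ⟨hσ, rfl, rfl, hprop⟩ := h
    obtain ⟨f, args, hl⟩ := (hR ρ hρ).root_term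
    have hdef : Sym.term f ∈ definedSyms R := ⟨ρ, hρ, args, hl⟩
    -- The redex is itself an active subterm, so it owns a leaf, where the dependency tuple is
    -- applied.
    have hactive : {ρ.lhs.subst σ} + M ≤ U.leaves := by
      refine le_trans ?_ hU
      gcongr
      rw [hl, Term.subst] at hns ⊢
      rw [Term.activeSubterms, if_pos ⟨hdef, hns⟩]
      simp
    obtain ⟨C, hC, hleaves⟩ := Term.exists_context_of_mem_leaves (ρ.lhs.subst σ) U
      (Multiset.mem_of_le hactive (by simp))
    have hsharp : (dependencyTuple R ρ).lhs.subst σ = (ρ.lhs.subst σ).sharp := by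
      rw [dependencyTuple, hl, Term.sharp_subst]
    refine ⟨C ((dependencyTuple R ρ).rhs.subst σ), ⟨σ, hC _ _ (.here _ _ ⟨hσ.dependencyTuple R,
      hsharp.symm, rfl, fun u hu => hsub _ hs hprop u ?_⟩)⟩, ?_⟩
    · rw [hl, Term.subst] at hu ⊢
      exact hu.of_sharp
    · have hr : (ρ.rhs.subst σ).activeSubterms R ≤
          ((dependencyTuple R ρ).rhs.subst σ).leaves := by
        rw [dependencyTuple, Term.leaves_tuple_subst, List.map_map]
        refine Term.activeSubterms_subst_le hR fun x hx => ?_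
        -- Variables of the left-hand side are bound inside the arguments of the redex, which are
        -- normal forms by the innermost condition; the others are bound to values.
        by_cases hxl : x ∈ ρ.lhs.vars
        · rw [hl] at hprop hxl
          exact Term.isNF_of_mem_vars
            (fun i => hprop _ (.arg (.term f) (fun i => (args i).subst σ) i)) hxl
        · exact Term.isNF_of_isValue hR (hσ.2 x ⟨hx, hxl⟩)
      -- The leaf of the redex is exchanged for the leaves of the instantiated tuple.
      rw [← add_le_add_iff_right {ρ.lhs.subst σ}, hleaves]
      refine le_trans (le_of_eq ?_) (add_le_add hactive hr)
      abel

/-! ### Counting applications of dependency tuples -/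

/-- The `B`-steps pending after the last counted step are absorbed into the next one. -/
theorem exists_chain_succ {r B : Term Sig → Term Sig → Prop} {n : ℕ} {c : ℕ → Term Sig}
    (hc : ∀ i < n, r (c i) (c (i + 1))) {u v : Term Sig} (hu : Relation.ReflTransGen B (c n) u)
    (hr : ∀ a, Relation.ReflTransGen B a u → r a v) :
    ∃ c' : ℕ → Term Sig, c' 0 = c 0 ∧ (∀ i < n + 1, r (c' i) (c' (i + 1))) ∧ c' (n + 1) = v := by
  refine ⟨Function.update c (n + 1) v, by simp, fun i hi => ?_, by simp⟩
  rw [Function.update_of_ne (by omega)]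
  rcases Nat.lt_succ_iff_lt_or_eq.1 hi with hi | rfl
  · rw [Function.update_of_ne (by omega)]
    exact hc i hi
  · rw [Function.update_self]
    exact hr _ hu

theorem CalcStep.simulate_reflTransGen {R : Set (Rule Sig)} (hR : IsLCTRS R) {s t : Term Sig}
    (h : Relation.ReflTransGen CalcStep s t) (hs : s.IsBase) {U : Term Sig}
    (hU : s.activeSubterms R ≤ U.leaves) :
    t.IsBase ∧ ∃ U', Relation.ReflTransGen (InnermostRewrite (dtSystem R)) U U' ∧
      t.activeSubterms R ≤ U'.leaves := by
  induction h with
  | refl => exact ⟨hs, U, .refl, hU⟩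
  | tail _ h ih =>
    obtain ⟨hb, V, h1, h2⟩ := ih
    obtain ⟨V', h3, h4⟩ := h.simulate hR hb h2
    exact ⟨h.isBase hb, V', h1.trans h3, h4⟩

theorem simulate_relative {R : Set (Rule Sig)} (hR : IsLCTRS R) {s t : Term Sig}
    (h : Relative (InnermostRuleStep R R) CalcStep s t) (hs : s.IsBase) {U : Term Sig}
    (hU : s.activeSubterms R ≤ U.leaves) :
    t.IsBase ∧ ∃ d : DT R, ∃ U', Relative (InnermostRuleStep (dtSystem R) {d.1})
      (InnermostRewrite (dtSystem R)) U U' ∧ t.activeSubterms R ≤ U'.leaves := by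
  obtain ⟨s', t', h1, ⟨ρ, hρ, h2⟩, h3⟩ := h
  obtain ⟨hs', V, hV, hs'V⟩ := CalcStep.simulate_reflTransGen hR h1 hs hU
  obtain ⟨W, W', hVW, hW, ht'⟩ := h2.simulate hR hρ hs' hs'V
  have hbt : t'.IsBase := by
    obtain ⟨σ, hσ⟩ := h2
    exact hσ.ruleStep.isBase (hR ρ hρ).rhs_base hs'
  obtain ⟨ht, U', hU', htU'⟩ := CalcStep.simulate_reflTransGen hR h3 hbt ht'
  exact ⟨ht, ⟨_, ρ, hρ, rfl⟩, U', ⟨W, W', hV.trans hVW, ⟨_, rfl, hW⟩, hU'⟩, htU'⟩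

theorem Relative.reflTransGen {R : Set (Rule Sig)} {ρ : Rule Sig} (hρ : ρ ∈ R) {s t : Term Sig}
    (h : Relative (InnermostRuleStep R {ρ}) (InnermostRewrite R) s t) :
    Relation.ReflTransGen (InnermostRewrite R) s t := by
  obtain ⟨s', t', h1, ⟨_, rfl, h2⟩, h3⟩ := h
  exact (h1.tail (.inr ⟨_, hρ, h2⟩)).trans h3

theorem le_dh {r : Term Sig → Term Sig → Prop} {c : ℕ → Term Sig} {n : ℕ}
    (hc : ∀ i < n, r (c i) (c (i + 1))) : (n : ℕ∞) ≤ dh (c 0) r :=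
  le_sSup ⟨n, rfl, c, rfl, hc⟩

open Classical in
/-- A derivation of length `k` is simulated by one in which the applications of dependency tuples
are recorded by a multiset `D` of cardinality `k`. -/
theorem exists_multiset_dependencyTuples {R : Set (Rule Sig)} (hR : IsLCTRS R) {U : Term Sig}
    {s : ℕ → Term Sig} (hs : (s 0).IsBase) (hU : (s 0).activeSubterms R ≤ U.leaves) {k : ℕ}
    (h : ∀ i < k, Relative (InnermostRuleStep R R) CalcStep (s i) (s (i + 1))) :
    ∃ D : Multiset (DT R), D.card = k ∧ ∀ d, (D.count d : ℕ∞) ≤ dh U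
      (Relative (InnermostRuleStep (dtSystem R) {d.1}) (InnermostRewrite (dtSystem R))) := by
  -- For the induction, one current term `V` is shared by all tuples, while each `d` has its own
  -- chain that cuts the derivation at the `d`-steps and reaches `V` by a possibly empty uncounted
  -- tail.
  suffices H : ∃ D : Multiset (DT R), D.card = k ∧ (s k).IsBase ∧
      ∃ V : Term Sig, (s k).activeSubterms R ≤ V.leaves ∧ ∀ d, ∃ c : ℕ → Term Sig, c 0 = U ∧
        (∀ i < D.count d, Relative (InnermostRuleStep (dtSystem R) {d.1})
          (InnermostRewrite (dtSystem R)) (c i) (c (i + 1))) ∧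
        Relation.ReflTransGen (InnermostRewrite (dtSystem R)) (c (D.count d)) V by
    obtain ⟨D, hD, -, V, -, hV⟩ := H
    refine ⟨D, hD, fun d => ?_⟩
    obtain ⟨c, rfl, hc, -⟩ := hV d
    exact le_dh hc
  induction k with
  | zero => exact ⟨0, rfl, hs, U, hU, fun d => ⟨fun _ => U, rfl, by simp, .refl⟩⟩
  | succ k ih =>
    obtain ⟨D, hD, hb, V, hV, hc⟩ := ih fun i hi => h i (by omega)
    obtain ⟨hb', d, V', hVV', hV'⟩ := simulate_relative hR (h k (by omega)) hb hV
    refine ⟨d ::ₘ D, by simp [hD], hb', V', hV', fun e => ?_⟩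
    obtain ⟨c, hc0, hc, hcV⟩ := hc e
    by_cases he : e = d
    · subst he
      obtain ⟨c', h0, hc', hlast⟩ := exists_chain_succ hc hcV (v := V') (by
        obtain ⟨W, W', h1, h2, h3⟩ := hVV'
        exact fun a ha => ⟨W, W', ha.trans h1, h2, h3⟩)
      rw [Multiset.count_cons_self]
      exact ⟨c', h0.trans hc0, hc', hlast ▸ .refl⟩
    -- From the viewpoint of another tuple `e`, the new step only lengthens the uncounted tail.
    · rw [Multiset.count_cons_of_ne he]
      exact ⟨c, hc0, hc, hcV.trans (hVV'.reflTransGen (.inl d.2))⟩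

/-! ### The initial term and the summation of the bounds -/

/-- This starts the invariant: with normal arguments only the root can be active, and the marked
term has exactly this leaf. -/
theorem Term.activeSubterms_le_leaves_sharp {R : Set (Rule Sig)} {f : Sig.TermSym}
    {args : Fin (Sym.term f).arity → Term Sig} (h : ∀ i, IsNF R (args i)) :
    (app (.term f) args).activeSubterms R ≤ (app (.term f) args).sharp.leaves := by
  rw [activeSubterms, Finset.sum_eq_zero fun i _ => activeSubterms_eq_zero (h i), add_zero,
    show (app (.term f) args).sharp.leaves = {app (.term f) args} from leaves_sharp f args]
  split_ifs <;> simp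

theorem toENNReal_sSup_le {A : Set ℕ∞} {B : ℝ≥0∞} (h : ∀ n ∈ A, (n : ℝ≥0∞) ≤ B) :
    ((sSup A : ℕ∞) : ℝ≥0∞) ≤ B := by
  rw [sSup_eq_iSup', ENat.toENNReal_iSup]
  exact iSup_le fun n => h n n.2

theorem Problem.IsRuntimeApprox.dh_le {P : Problem Sig} {T : P.D → UB Sig}
    (hT : P.IsRuntimeApprox T) {m : Sig.Var → ℕ} {σ : Subst Sig}
    (hσ : Admissible P.t P.φ (fun x => m x) σ) (ρ : P.D) :
    ((dh (P.t.subst σ) (Relative (InnermostRuleStep (P.D ∪ P.R) {ρ.1})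
      (InnermostRewrite (P.D ∪ P.R))) : ℕ∞) : ℝ≥0∞) ≤ ((T ρ).eval m).toENNReal := by
  -- Truncating negative values to zero is harmless, since the left-hand side is a nonnegative
  -- extended number.
  have h := EReal.toENNReal_le_toENNReal (hT ρ m)
  rw [EReal.toENNReal_coe] at h
  exact le_trans (ENat.toENNReal_le.2 (le_sSup (Exists.intro σ ⟨hσ, rfl⟩))) h

theorem Admissible.sharp {t φ : Term Sig} {m : Sig.Var → ℕ} {σ : Subst Sig}
    (h : Admissible t φ (fun x => m x) σ) : Admissible t.sharp φ (fun x => m x) σ :=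
  ⟨h.1, fun x => h.2 ⟨x, t.vars_sharp ▸ x.2⟩⟩

end LCTRS

theorem mainTheorem1 {Sig : LCTRS.Signature.{u}} (R : Set (LCTRS.Rule Sig))
    (hR : LCTRS.IsLCTRS R) (t φ : LCTRS.Term Sig) (hinit : LCTRS.IsInitialState R t φ)
    (T : (LCTRS.dtProblem R t φ).D → LCTRS.UB Sig)
    (S : (LCTRS.dtProblem R t φ).EV → LCTRS.UB Sig)
    (hvalid : (LCTRS.dtProblem R t φ).ValidJudgement T S) :
    ∀ m : Sig.Var → ℕ,
      ((LCTRS.rc R t φ (fun x => m x) : ℕ∞) : ℝ≥0∞) ≤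
        ∑' ρ : (LCTRS.dtProblem R t φ).D, ((T ρ).eval m).toENNReal := by
  classical
  intro m
  refine LCTRS.toENNReal_sSup_le ?_
  rintro _ ⟨σ, hσ, rfl⟩
  refine LCTRS.toENNReal_sSup_le ?_
  rintro _ ⟨k, rfl, s, hs, hstep⟩
  obtain ⟨-, -, f, x, rfl, -⟩ := hinit
  have hval : ∀ i, (σ.toFun (x i)).IsValue := fun i => by
    obtain ⟨ι, a, h, -⟩ := hσ.2 ⟨x i, Set.mem_iUnion.2 ⟨i, rfl⟩⟩
    exact ⟨ι, a, h⟩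
  obtain ⟨D, hD, hcount⟩ := LCTRS.exists_multiset_dependencyTuples hR
    (U := (LCTRS.Term.app (.term f) fun i => .var (x i)).sharp.subst σ) (s := s) (k := k)
    (by rw [hs]; exact LCTRS.Term.isBase_app.2
          ⟨trivial, fun i => LCTRS.Term.isBase_of_isValue (hval i)⟩)
    (by rw [hs]; exact LCTRS.Term.activeSubterms_le_leaves_sharp fun i =>
          LCTRS.Term.isNF_of_isValue hR (hval i)) hstep
  -- Only the finitely many tuples in `D` are summed, so `R` may be infinite.
  calc ((k : ℕ∞) : ℝ≥0∞) = ∑ d ∈ D.toFinset, (D.count d : ℝ≥0∞) := by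
        rw [← Nat.cast_sum, Multiset.toFinset_sum_count_eq, hD, ENat.toENNReal_coe]
    _ ≤ ∑ d ∈ D.toFinset, ((T d).eval m).toENNReal := Finset.sum_le_sum fun d _ => by
        refine le_trans ?_ (hvalid.1.dh_le hσ.sharp d)
        rw [← ENat.toENNReal_coe]
        exact ENat.toENNReal_le.2 (hcount d)
    _ ≤ _ := ENNReal.sum_le_tsum _
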